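/- **Theorem.** Let $d,k,m,n$ be natural numbers with $k<m<d-k$ and $n\ge m$. Let $v_\star\in\mathbb R^k$ with $v_\star\neq 0$, and let $B_\star\in\mathbb R^{k\times d}$ have orthonormal rows; the label of an input $x\in\mathbb R^d$ is $v_\star^\top B_\star x$. Let $S\subset\mathbb R^d$ be an $m$-dimensional subspace, and let $P_{\mathrm{id}}$ be the law of $Fz$, where the columns of $F\in\mathbb R^{d\times m}$ form an orthonormal basis of $S$ and $z\in\mathbb R^m$ has a probability law that has a density. Let $P_{\mathrm{ood}}$ be a probability law on $\mathbb R^d$ with finite and invertible second moment matrix $\mathbb E[xx^\top]$, and put $$L_{\mathrm{ood}}(v,B)=\mathbb E_{x\sim P_{\mathrm{ood}}}\big[(v^\top Bx-v_\star^\top B_\star x)^2\big].$$ For subspaces $R,T$ of $\mathbb R^d$ let $\cos\theta_{\max}(R,T)=\sigma_r(E^\top G)$, where $E,G$ have orthonormal columns spanning $R,T$, $r=\min(\dim R,\dim T)$, and $\sigma_r$ is the $r$-th largest singular value. Let $R_\star=\mathrm{rowspace}(B_\star)$ and assume $\cos\theta_{\max}(R_\star,S)>0$ and $\cos\theta_{\max}(R_\star,S^\perp)>0$.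 Let $B_0^i\in\mathbb R^{k\times d}$ $(i\in\mathbb N)$ have orthonormal rows, with $d(B_0^i,B_\star)\to0$ as $i\to\infty$, where $d(B,B')=\min_U\|B-UB'\|_2$ over orthogonal $U\in\mathbb R^{k\times k}$, in the spectral norm. Let $X\in\mathbb R^{n\times d}$ be random with i.i.d. rows of law $P_{\mathrm{id}}$, let $Y=XB_\star^\top v_\star$, and let $v_0\sim N(0,\sigma^2I_k)$ be a random head, for some $\sigma^2\ge 0$. For the training loss $\hat L(v,B)=\|XB^\top v-Y\|_2^2$, let $v^i_{\mathrm{lp}}(t)$, $t\ge0$, be the linear-probing flow $$\dot v=-\nabla_v\hat L(v,B_0^i),\qquad v(0)=v_0,$$ and let $(v^i_{\mathrm{ft}}(t),B^i_{\mathrm{ft}}(t))$, $t\ge0$, be the fine-tuning flow $$\dot v=-\nabla_v\hat L(v,B),\quad \dot B=-\nabla_B\hat L(v,B),\qquad (v,B)(0)=(v_0,B_0^i).$$ Then the limits $v^{\infty,i}_{\mathrm{lp}}=\lim_{t\to\infty}v^i_{\mathrm{lp}}(t)$ exist, the probability that $\inf_{t\ge0}L_{\mathrm{ood}}(v^i_{\mathrm{ft}}(t),B^i_{\mathrm{ft}}(t))=0$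 tends to $0$ as $i\to\infty$, and $$\frac{L_{\mathrm{ood}}(v^{\infty,i}_{\mathrm{lp}},B_0^i)}{\inf_{t\ge0}L_{\mathrm{ood}}(v^i_{\mathrm{ft}}(t),B^i_{\mathrm{ft}}(t))}\ \xrightarrow{\ p\ }\ 0\qquad(i\to\infty).$$ -/

import Mathlib

open MeasureTheory ProbabilityTheory Filter Topology
open scoped Matrix NNReal ENNReal

namespace LinearTransfer

/-- Row space of a `k × d` matrix, as a subspace of Euclidean `ℝ^d`. -/
def rowspace {k d : ℕ} (B : Matrix (Fin k) (Fin d) ℝ) :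
    Submodule ℝ (EuclideanSpace ℝ (Fin d)) :=
  Submodule.span ℝ (Set.range fun a => WithLp.toLp 2 (B a))

/-- Cosine of the largest principal angle between two subspaces `R` and `S`: the `r`-th largest
singular value, `r = min (dim R) (dim S)`, of the map `S → R` that projects orthogonally onto `R`.
In orthonormal bases `E` of `R` and `F` of `S` this map has matrix `Eᵀ F`.
(Mathlib's singular values are indexed from `0`.) -/
noncomputable def cosMaxAngle {d : ℕ} (R S : Submodule ℝ (EuclideanSpace ℝ (Fin d))) : ℝ :=
  (R.orthogonalProjectionOnto.toLinearMap ∘ₗ S.subtype).singularValues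
    (min (Module.finrank ℝ R) (Module.finrank ℝ S) - 1)

/-- Spectral norm (largest singular value) of a matrix. -/
noncomputable def spectralNorm2 {k d : ℕ} (A : Matrix (Fin k) (Fin d) ℝ) : ℝ :=
  ‖(Matrix.toEuclideanLin A).toContinuousLinearMap‖

/-- Distance of feature extractors: minimum over orthogonal `k × k` matrices `U` of the spectral
norm of `B - U B'`. -/
noncomputable def extractorDist {k d : ℕ} (B B' : Matrix (Fin k) (Fin d) ℝ) : ℝ :=
  ⨅ U : Matrix.orthogonalGroup (Fin k) ℝ,
    spectralNorm2 (B - (U : Matrix (Fin k) (Fin k) ℝ) * B')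

/-- Second moment matrix `E[x xᵀ]`. -/
noncomputable def secondMoment {d : ℕ} (P : Measure (Fin d → ℝ)) : Matrix (Fin d) (Fin d) ℝ :=
  Matrix.of fun i j => ∫ x, x i * x j ∂P

/-- Law of `F z`, where `z` has a density on `ℝ^m` and the columns of `F` are an orthonormal basis
of the subspace `S`. -/
def IsSubspaceLaw {d : ℕ} (m : ℕ) (S : Submodule ℝ (EuclideanSpace ℝ (Fin d)))
    (Pid : Measure (Fin d → ℝ)) : Prop :=
  ∃ (Pz : Measure (Fin m → ℝ)) (F : Matrix (Fin d) (Fin m) ℝ),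
    IsProbabilityMeasure Pz ∧ Pz ≪ volume ∧ Fᵀ * F = 1 ∧ rowspace Fᵀ = S ∧
      Pid = Pz.map fun z => F *ᵥ z

/-- The Gaussian law `N(0, σ² I_k)`. -/
noncomputable def isoGaussian (k : ℕ) (σsq : ℝ≥0) : Measure (Fin k → ℝ) :=
  Measure.pi fun _ => gaussianReal 0 σsq

/-- Expected squared error of the model `x ↦ vᵀ B x` under inputs of law `P`, with labels
`vsᵀ Bs x`. -/
noncomputable def risk {k d : ℕ} (P : Measure (Fin d → ℝ)) (vs : Fin k → ℝ)
    (Bs : Matrix (Fin k) (Fin d) ℝ) (v : Fin k → ℝ) (B : Matrix (Fin k) (Fin d) ℝ) : ℝ :=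
  ∫ x, (v ⬝ᵥ (B *ᵥ x) - vs ⬝ᵥ (Bs *ᵥ x)) ^ 2 ∂P

/-- Training loss `‖X Bᵀ v - Y‖₂²`; the rows of `X` are the training inputs. -/
def trainLoss {n k d : ℕ} (X : Matrix (Fin n) (Fin d) ℝ) (Y : Fin n → ℝ)
    (v : Fin k → ℝ) (B : Matrix (Fin k) (Fin d) ℝ) : ℝ :=
  ∑ j, ((X *ᵥ (Bᵀ *ᵥ v)) j - Y j) ^ 2

/-- Gradient of the training loss in the head: its entries are the partial derivatives in the
entries of `v`. -/
noncomputable def gradHead {n k d : ℕ} (X : Matrix (Fin n) (Fin d) ℝ) (Y : Fin n → ℝ)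
    (v : Fin k → ℝ) (B : Matrix (Fin k) (Fin d) ℝ) : Fin k → ℝ :=
  fun a => deriv (fun s : ℝ => trainLoss X Y (v + s • Pi.single a 1) B) 0

/-- Gradient of the training loss in the feature extractor: its entries are the partial derivatives
in the entries of `B`. -/
noncomputable def gradExtractor {n k d : ℕ} (X : Matrix (Fin n) (Fin d) ℝ) (Y : Fin n → ℝ)
    (v : Fin k → ℝ) (B : Matrix (Fin k) (Fin d) ℝ) : Matrix (Fin k) (Fin d) ℝ :=
  Matrix.of fun a l => deriv (fun s : ℝ => trainLoss X Y v (B + s • Matrix.single a l 1)) 0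

/-- `(v, B)` is the fine-tuning trajectory on `[0, ∞)`: the gradient flow of the training loss in
both the head and the feature extractor, started at `(v₀, B₀)`. -/
structure IsFineTuning {n k d : ℕ} (X : Matrix (Fin n) (Fin d) ℝ) (Y : Fin n → ℝ)
    (v₀ : Fin k → ℝ) (B₀ : Matrix (Fin k) (Fin d) ℝ)
    (v : ℝ → Fin k → ℝ) (B : ℝ → Matrix (Fin k) (Fin d) ℝ) : Prop where
  init_head : v 0 = v₀
  init_extractor : B 0 = B₀
  flow_head : ∀ t, 0 ≤ t → ∀ a,
    HasDerivWithinAt (fun s => v s a) (-gradHead X Y (v t) (B t) a) (Set.Ici 0) t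
  flow_extractor : ∀ t, 0 ≤ t → ∀ a l,
    HasDerivWithinAt (fun s => B s a l) (-gradExtractor X Y (v t) (B t) a l) (Set.Ici 0) t

/-- `v` is the linear probing trajectory on `[0, ∞)`: the gradient flow of the training loss in the
head alone, with the feature extractor frozen at `B₀`, started at `v₀`. -/
structure IsLinearProbing {n k d : ℕ} (X : Matrix (Fin n) (Fin d) ℝ) (Y : Fin n → ℝ)
    (v₀ : Fin k → ℝ) (B₀ : Matrix (Fin k) (Fin d) ℝ) (v : ℝ → Fin k → ℝ) : Prop where
  init_head : v 0 = v₀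
  flow_head : ∀ t, 0 ≤ t → ∀ a,
    HasDerivWithinAt (fun s => v s a) (-gradHead X Y (v t) B₀ a) (Set.Ici 0) t

/-- Infimum over all times `t ≥ 0` of the risk along a trajectory. -/
noncomputable def infRisk {k d : ℕ} (P : Measure (Fin d → ℝ)) (vs : Fin k → ℝ)
    (Bs : Matrix (Fin k) (Fin d) ℝ) (v : ℝ → Fin k → ℝ)
    (B : ℝ → Matrix (Fin k) (Fin d) ℝ) : ℝ :=
  ⨅ t : Set.Ici (0 : ℝ), risk P vs Bs (v t) (B t)

end LinearTransfer

/-!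
The argument compares two rates. Along the convergent extractors, rotated so that they tend to `Bs`
itself (`exists_rotations`), the risk of linear probing tends to zero in probability, while the risk
of fine-tuning is bounded below, uniformly in time and with probability close to one.

*Fine-tuning.* The gradient flow conserves `v vᵀ - B Bᵀ` and never changes `B` in the directions
orthogonal to the training subspace `S` (`IsFineTuning.balanced`,
`IsFineTuning.mul_eq_of_mul_eq_zero`). The risk is an invertible quadratic form in the coefficient
error `Bᵀ v - Bsᵀ vs`, so a small risk at any time forces `Bᵀ v ≈ Bsᵀ vs`. Restricting this to `Sᗮ`,
where `B` is still the initial extractor and where the angle condition makes `Bsᵀ` injective, gives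
`v ≈ vs`. Evaluating the conserved quadratic form at `v` then yields `(v₀ ⬝ᵥ vs)² ≈ |vs|⁴`
(`tendsto_initial_head_sq`). The law of `v₀ ⬝ᵥ U vs` is the same centred Gaussian for every
orthogonal `U`, and it gives small mass to a thin neighbourhood of `± |vs|²`
(`exists_measure_head_near_le`).

*Linear probing.* The flow is linear and converges to a solution of the normal equations
(`IsLinearProbing.exists_tendsto`). Almost surely the `k` vectors `Bs x₁, …, Bs x_k` are linearly
independent, because their law charges no proper subspace, so the normal equations are nonsingular
at `Bs` and their solution depends continuously on the extractor (`tendsto_measure_linearProbing`).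

Nothing is assumed about measurability of the trajectories in the outcome; all exceptional events
are covered by events that are measurable in the training inputs or in the initial head.
-/

namespace LinearTransfer

/-! ### Principal angles and injectivity -/

lemma finrank_rowspace {k d : ℕ} {B : Matrix (Fin k) (Fin d) ℝ} (hB : B * Bᵀ = 1) :
    Module.finrank ℝ (rowspace B) = k := by
  have ho : Orthonormal ℝ (fun a => (WithLp.toLp 2 (B a) : EuclideanSpace ℝ (Fin d))) := by
    rw [orthonormal_iff_ite]
    intro a b
    rw [EuclideanSpace.inner_eq_star_dotProduct, star_trivial, dotProduct_comm]
    exact (congrFun (congrFun hB a) b).trans Matrix.one_apply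
  rw [rowspace, finrank_span_eq_card ho.linearIndependent, Fintype.card_fin]

lemma toLp_mem_rowspace {k d : ℕ} (B : Matrix (Fin k) (Fin d) ℝ) (u : Fin k → ℝ) :
    WithLp.toLp 2 (Bᵀ *ᵥ u) ∈ rowspace B := by
  refine (Submodule.mem_span_range_iff_exists_fun ℝ).2 ⟨u, ?_⟩
  ext l
  simp [Matrix.mulVec, dotProduct, mul_comm]

lemma toLp_mem_rowspace_orthogonal {k d : ℕ} {B : Matrix (Fin k) (Fin d) ℝ} {y : Fin d → ℝ}
    (hy : B *ᵥ y = 0) : WithLp.toLp 2 y ∈ (rowspace B)ᗮ := by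
  rw [rowspace, Submodule.mem_orthogonal]
  intro x hx
  induction hx using Submodule.span_induction with
  | mem x hx =>
    obtain ⟨a, rfl⟩ := hx
    rw [EuclideanSpace.inner_eq_star_dotProduct, star_trivial, dotProduct_comm]
    exact congrFun hy a
  | zero => simp
  | add x z _ _ hx hz => rw [inner_add_left, hx, hz, add_zero]
  | smul c x _ hx => rw [inner_smul_left, hx, mul_zero]

/-- If the largest principal angle between `R` and a subspace `S` of at least the same dimension is
acute, the projection `S → R` is onto, hence no nonzero vector of `R` is orthogonal to `S`. -/
lemma eq_zero_of_cosMaxAngle_pos {d : ℕ} {R S : Submodule ℝ (EuclideanSpace ℝ (Fin d))}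
    (hle : Module.finrank ℝ R ≤ Module.finrank ℝ S) (h : 0 < cosMaxAngle R S)
    {x : EuclideanSpace ℝ (Fin d)} (hx : x ∈ R) (hxS : x ∈ Sᗮ) : x = 0 := by
  rw [cosMaxAngle, LinearMap.singularValues_pos_iff_lt_finrank_range, min_eq_left hle] at h
  have htop := Submodule.eq_top_of_finrank_eq
    (le_antisymm (Submodule.finrank_le _) (by omega : Module.finrank ℝ R ≤ Module.finrank ℝ
      (R.orthogonalProjectionOnto.toLinearMap ∘ₗ S.subtype).range))
  obtain ⟨s, hs⟩ := (htop ▸ Submodule.mem_top :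
    (⟨x, hx⟩ : R) ∈ (R.orthogonalProjectionOnto.toLinearMap ∘ₗ S.subtype).range)
  have h1 := Submodule.inner_orthogonalProjectionOnto_eq_of_mem_right (⟨x, hx⟩ : R) (s : _)
  have h2 : R.orthogonalProjectionOnto (s : EuclideanSpace ℝ (Fin d)) = ⟨x, hx⟩ := hs
  rw [h2, (Submodule.mem_orthogonal S x).1 hxS s s.2] at h1
  exact congrArg Subtype.val (inner_self_eq_zero.1 h1)

lemma exists_leftInverse {p k : ℕ} {M : Matrix (Fin p) (Fin k) ℝ}
    (hM : ∀ u, M *ᵥ u = 0 → u = 0) : ∃ L : Matrix (Fin k) (Fin p) ℝ, L * M = 1 := by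
  obtain ⟨g, hg⟩ := LinearMap.exists_leftInverse_of_injective (Matrix.toLin' M)
    (LinearMap.ker_eq_bot'.2 hM)
  refine ⟨LinearMap.toMatrix' g, ?_⟩
  have h := congrArg LinearMap.toMatrix' hg
  rwa [LinearMap.toMatrix'_comp, LinearMap.toMatrix'_id, LinearMap.toMatrix'_toLin'] at h

/-- The angle condition between `rowspace Bs` and `S`, in matrix form. -/
lemma exists_leftInverse_of_angle {d k m : ℕ} (hkm : k ≤ m) {Bs : Matrix (Fin k) (Fin d) ℝ}
    (hBs : Bs * Bsᵀ = 1) {F : Matrix (Fin d) (Fin m) ℝ} (hF : Fᵀ * F = 1)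
    (hS : 0 < cosMaxAngle (rowspace Bs) (rowspace Fᵀ)) :
    ∃ L : Matrix (Fin k) (Fin m) ℝ, L * (Fᵀ * Bsᵀ) = 1 := by
  refine exists_leftInverse fun u hu => ?_
  have hF' : Module.finrank ℝ (rowspace Fᵀ) = m :=
    finrank_rowspace (by rwa [Matrix.transpose_transpose])
  have h := eq_zero_of_cosMaxAngle_pos (by rw [finrank_rowspace hBs, hF']; exact hkm) hS
    (toLp_mem_rowspace Bs u) (toLp_mem_rowspace_orthogonal (by rwa [Matrix.mulVec_mulVec]))
  have h' : Bsᵀ *ᵥ u = 0 := congrArg WithLp.ofLp h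
  rw [← Matrix.one_mulVec u, ← hBs, ← Matrix.mulVec_mulVec, h', Matrix.mulVec_zero]

/-- The angle condition between `rowspace Bs` and `Sᗮ`, in matrix form; `1 - F * Fᵀ` is the
orthogonal projection onto `Sᗮ`. -/
lemma exists_leftInverse_of_angle_orthogonal {d k m : ℕ} (hmd : m + k ≤ d)
    {Bs : Matrix (Fin k) (Fin d) ℝ}
    (hBs : Bs * Bsᵀ = 1) {F : Matrix (Fin d) (Fin m) ℝ} (hF : Fᵀ * F = 1)
    (hS : 0 < cosMaxAngle (rowspace Bs) (rowspace Fᵀ)ᗮ) :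
    ∃ L : Matrix (Fin k) (Fin d) ℝ, L * ((1 - F * Fᵀ) * Bsᵀ) = 1 := by
  refine exists_leftInverse fun u hu => ?_
  have hF' : Module.finrank ℝ (rowspace Fᵀ) = m :=
    finrank_rowspace (by rwa [Matrix.transpose_transpose])
  have hdim := Submodule.finrank_add_finrank_orthogonal (rowspace Fᵀ)
  rw [hF', finrank_euclideanSpace_fin] at hdim
  rw [Matrix.sub_mul, Matrix.one_mul, Matrix.sub_mulVec, sub_eq_zero, Matrix.mul_assoc,
    ← Matrix.mulVec_mulVec] at hu
  have h := eq_zero_of_cosMaxAngle_pos (by rw [finrank_rowspace hBs]; omega) hS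
    (toLp_mem_rowspace Bs u) (Submodule.le_orthogonal_orthogonal _
      (by rw [hu]; exact toLp_mem_rowspace Fᵀ _))
  have h' : Bsᵀ *ᵥ u = 0 := congrArg WithLp.ofLp h
  rw [← Matrix.one_mulVec u, ← hBs, ← Matrix.mulVec_mulVec, h', Matrix.mulVec_zero]

/-! ### Gradients and conservation laws -/

/-- The gradient of half the training loss in the coefficient vector `Bᵀ v`. -/
def residualGrad {n d : ℕ} (X : Matrix (Fin n) (Fin d) ℝ) (Y : Fin n → ℝ) (b : Fin d → ℝ) :
    Fin d → ℝ :=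
  Xᵀ *ᵥ (X *ᵥ b - Y)

lemma hasDerivAt_sum_sq {n : ℕ} (p q : Fin n → ℝ) :
    HasDerivAt (fun s : ℝ => ∑ j, (p j + s * q j) ^ 2) (2 * (q ⬝ᵥ p)) 0 := by
  rw [dotProduct, Finset.mul_sum]
  refine HasDerivAt.fun_sum fun j _ => ?_
  have h := (((hasDerivAt_id (0 : ℝ)).mul_const (q j)).const_add (p j)).pow 2
  refine h.congr_deriv ?_
  simp
  ring

lemma mulVec_dotProduct {p q : ℕ} (A : Matrix (Fin p) (Fin q) ℝ) (x : Fin q → ℝ) (y : Fin p → ℝ) :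
    (A *ᵥ x) ⬝ᵥ y = x ⬝ᵥ (Aᵀ *ᵥ y) := by
  rw [dotProduct_comm, Matrix.dotProduct_mulVec, ← Matrix.mulVec_transpose, dotProduct_comm]

lemma gradHead_eq {n k d : ℕ} (X : Matrix (Fin n) (Fin d) ℝ) (Y : Fin n → ℝ)
    (v : Fin k → ℝ) (B : Matrix (Fin k) (Fin d) ℝ) :
    gradHead X Y v B = (2 : ℝ) • (B *ᵥ residualGrad X Y (Bᵀ *ᵥ v)) := by
  funext a
  have h := hasDerivAt_sum_sq (X *ᵥ (Bᵀ *ᵥ v) - Y) (X *ᵥ (Bᵀ *ᵥ Pi.single a 1))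
  rw [gradHead, show (fun s : ℝ => trainLoss X Y (v + s • Pi.single a 1) B) = fun s : ℝ =>
    ∑ j, ((X *ᵥ (Bᵀ *ᵥ v) - Y) j + s * (X *ᵥ (Bᵀ *ᵥ Pi.single a 1)) j) ^ 2 from ?_, h.deriv]
  · rw [Pi.smul_apply, smul_eq_mul, residualGrad, mulVec_dotProduct, mulVec_dotProduct,
      single_one_dotProduct, Matrix.transpose_transpose]
  · funext s
    refine Finset.sum_congr rfl fun j _ => ?_
    simp only [Matrix.mulVec_add, Matrix.mulVec_smul, Pi.add_apply, Pi.smul_apply, smul_eq_mul,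
      Pi.sub_apply]
    ring

lemma gradExtractor_eq {n k d : ℕ} (X : Matrix (Fin n) (Fin d) ℝ) (Y : Fin n → ℝ)
    (v : Fin k → ℝ) (B : Matrix (Fin k) (Fin d) ℝ) (a : Fin k) (l : Fin d) :
    gradExtractor X Y v B a l = 2 * (v a * residualGrad X Y (Bᵀ *ᵥ v) l) := by
  have h := hasDerivAt_sum_sq (X *ᵥ (Bᵀ *ᵥ v) - Y) (X *ᵥ Pi.single l (v a))
  have hs : (Matrix.single a l (1 : ℝ))ᵀ *ᵥ v = Pi.single l (v a) := by
    rw [Matrix.transpose_single, Matrix.single_mulVec, one_mul]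
    rfl
  rw [gradExtractor, Matrix.of_apply, show (fun s : ℝ => trainLoss X Y v
    (B + s • Matrix.single a l 1)) = fun s : ℝ =>
    ∑ j, ((X *ᵥ (Bᵀ *ᵥ v) - Y) j + s * (X *ᵥ Pi.single l (v a)) j) ^ 2 from ?_, h.deriv]
  · rw [mulVec_dotProduct, single_dotProduct, residualGrad]
  · funext s
    refine Finset.sum_congr rfl fun j _ => ?_
    simp only [Matrix.transpose_add, Matrix.transpose_smul, Matrix.add_mulVec, Matrix.smul_mulVec,
      hs, Matrix.mulVec_add, Matrix.mulVec_smul, Pi.add_apply, Pi.smul_apply, smul_eq_mul,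
      Pi.sub_apply]
    ring

lemma eq_of_hasDerivWithinAt_Ici_zero {f : ℝ → ℝ}
    (h : ∀ t, 0 ≤ t → HasDerivWithinAt f 0 (Set.Ici 0) t) {t : ℝ} (ht : 0 ≤ t) : f t = f 0 :=
  constant_of_has_deriv_right_zero
    (fun s hs => ((h s hs.1).mono Set.Icc_subset_Ici_self).continuousWithinAt)
    (fun s hs => (h s hs.1).mono (Set.Ici_subset_Ici.2 hs.1)) t ⟨ht, le_rfl⟩

/-- Along the fine-tuning flow, `v vᵀ - B Bᵀ` is conserved. -/
lemma IsFineTuning.balanced {n k d : ℕ} {X : Matrix (Fin n) (Fin d) ℝ} {Y : Fin n → ℝ}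
    {v₀ : Fin k → ℝ} {B₀ : Matrix (Fin k) (Fin d) ℝ} {v : ℝ → Fin k → ℝ}
    {B : ℝ → Matrix (Fin k) (Fin d) ℝ} (h : IsFineTuning X Y v₀ B₀ v B) {t : ℝ} (ht : 0 ≤ t) :
    Matrix.vecMulVec (v t) (v t) - B t * (B t)ᵀ = Matrix.vecMulVec v₀ v₀ - B₀ * B₀ᵀ := by
  ext a b
  have key := eq_of_hasDerivWithinAt_Ici_zero
    (f := fun s => v s a * v s b - ∑ l, B s a l * B s b l) (fun s hs => ?_) ht
  · rw [h.init_head, h.init_extractor] at key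
    simpa [Matrix.vecMulVec_apply, Matrix.mul_apply] using key
  · have hd := ((h.flow_head s hs a).mul (h.flow_head s hs b)).sub
      (HasDerivWithinAt.fun_sum fun l (_ : l ∈ Finset.univ) =>
        (h.flow_extractor s hs a l).mul (h.flow_extractor s hs b l))
    refine hd.congr_deriv ?_
    simp only [gradHead_eq, gradExtractor_eq, Pi.smul_apply, smul_eq_mul, Matrix.mulVec,
      dotProduct, Finset.mul_sum, Finset.sum_mul, ← Finset.sum_neg_distrib,
      ← Finset.sum_add_distrib, ← Finset.sum_sub_distrib]
    refine Finset.sum_eq_zero fun l _ => ?_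
    ring

/-- Along the fine-tuning flow the extractor is frozen in the directions orthogonal to the training
inputs. -/
lemma IsFineTuning.mul_eq_of_mul_eq_zero {n k d : ℕ} {X : Matrix (Fin n) (Fin d) ℝ} {Y : Fin n → ℝ}
    {v₀ : Fin k → ℝ} {B₀ : Matrix (Fin k) (Fin d) ℝ} {v : ℝ → Fin k → ℝ}
    {B : ℝ → Matrix (Fin k) (Fin d) ℝ} (h : IsFineTuning X Y v₀ B₀ v B)
    {Q : Matrix (Fin d) (Fin d) ℝ} (hQ : X * Q = 0) {t : ℝ} (ht : 0 ≤ t) : B t * Q = B₀ * Q := by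
  ext a b
  have key := eq_of_hasDerivWithinAt_Ici_zero (f := fun s => ∑ l, B s a l * Q l b)
    (fun s hs => ?_) ht
  · rw [h.init_extractor] at key
    simpa [Matrix.mul_apply] using key
  · refine (HasDerivWithinAt.fun_sum fun l (_ : l ∈ Finset.univ) =>
        (h.flow_extractor s hs a l).mul_const (Q l b)).congr_deriv ?_
    have h0 : ∑ l, residualGrad X Y ((B s)ᵀ *ᵥ v s) l * Q l b = 0 := by
      change (residualGrad X Y ((B s)ᵀ *ᵥ v s) ᵥ* Q) b = 0
      rw [residualGrad, Matrix.mulVec_transpose, Matrix.vecMul_vecMul, hQ, Matrix.vecMul_zero,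
        Pi.zero_apply]
    calc _ = (-(2 * v s a)) * ∑ l, residualGrad X Y ((B s)ᵀ *ᵥ v s) l * Q l b := by
          rw [Finset.mul_sum]
          refine Finset.sum_congr rfl fun l _ => ?_
          rw [gradExtractor_eq]
          ring
      _ = 0 := by rw [h0, mul_zero]

/-! ### Fine-tuning -/

lemma tendsto_zero_of_sq {α : Type*} {l : Filter α} {f : α → ℝ}
    (h : Tendsto (fun x => f x ^ 2) l (𝓝 0)) : Tendsto f l (𝓝 0) := by
  have h' := (Real.continuous_sqrt.tendsto 0).comp h
  rw [Real.sqrt_zero] at h'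
  refine tendsto_zero_iff_abs_tendsto_zero _ |>.2 (h'.congr fun x => ?_)
  exact Real.sqrt_sq_eq_abs (f x)

lemma dotProduct_sq_le {p : ℕ} (x y : Fin p → ℝ) : (x ⬝ᵥ y) ^ 2 ≤ (x ⬝ᵥ x) * (y ⬝ᵥ y) := by
  have h := Finset.sum_mul_sq_le_sq_mul_sq Finset.univ x y
  simpa only [dotProduct, sq] using h

lemma zero_le_dotProduct_self {p : ℕ} (x : Fin p → ℝ) : 0 ≤ x ⬝ᵥ x :=
  Finset.sum_nonneg fun i _ => mul_self_nonneg (x i)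

/-- If `D → 1` and `D v → w`, then `v → w`. -/
lemma tendsto_of_tendsto_mulVec {α : Type*} {l : Filter α} {k : ℕ}
    {D : α → Matrix (Fin k) (Fin k) ℝ} {v : α → Fin k → ℝ} {w : Fin k → ℝ}
    (hD : Tendsto D l (𝓝 1)) (hv : Tendsto (fun x => D x *ᵥ v x) l (𝓝 w)) :
    Tendsto v l (𝓝 w) := by
  have hdet : Tendsto (fun x => (D x).det) l (𝓝 1) := by
    have h := (Continuous.matrix_det continuous_id).tendsto (1 : Matrix (Fin k) (Fin k) ℝ)
    rw [id, Matrix.det_one] at h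
    exact h.comp hD
  have hadj : Tendsto (fun x => (D x).adjugate) l (𝓝 1) := by
    have h := (Continuous.matrix_adjugate continuous_id).tendsto (1 : Matrix (Fin k) (Fin k) ℝ)
    rw [id, Matrix.adjugate_one] at h
    exact h.comp hD
  have hmul : Tendsto (fun x => (D x).adjugate *ᵥ (D x *ᵥ v x)) l (𝓝 w) := by
    have h := ((continuous_fst.matrix_mulVec continuous_snd).tendsto
      ((1 : Matrix (Fin k) (Fin k) ℝ), w)).comp (hadj.prodMk_nhds hv)
    rwa [Matrix.one_mulVec] at h
  have h := (hdet.inv₀ one_ne_zero).smul hmul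
  rw [inv_one, one_smul] at h
  refine h.congr' ?_
  filter_upwards [hdet.eventually_ne one_ne_zero] with x hx
  rw [Matrix.mulVec_mulVec, Matrix.adjugate_mul, Matrix.smul_mulVec, Matrix.one_mulVec,
    inv_smul_smul₀ hx]

/-- The quadratic form of the conserved matrix `v vᵀ - B Bᵀ = v₀ v₀ᵀ - 1`. -/
lemma balanced_quadratic {k d : ℕ} {v v₀ : Fin k → ℝ} {B C : Matrix (Fin k) (Fin d) ℝ}
    (h : Matrix.vecMulVec v v - B * Bᵀ = Matrix.vecMulVec v₀ v₀ - C * Cᵀ) (hC : C * Cᵀ = 1)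
    (u : Fin k → ℝ) :
    (v ⬝ᵥ u) ^ 2 - (Bᵀ *ᵥ u) ⬝ᵥ (Bᵀ *ᵥ u) = (v₀ ⬝ᵥ u) ^ 2 - u ⬝ᵥ u := by
  have h1 := congrArg (fun M => u ⬝ᵥ (M *ᵥ u)) h
  simp only [hC, Matrix.sub_mulVec, dotProduct_sub, Matrix.vecMulVec_mulVec, Matrix.one_mulVec,
    ← Matrix.mulVec_mulVec] at h1
  rw [mulVec_dotProduct, Matrix.transpose_transpose]
  rw [dotProduct_comm v, dotProduct_comm v₀]
  simpa [sq, dotProduct_comm] using h1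

/-- If the learned coefficient vector `Bᵀ v` approaches `Bsᵀ vs` while `B` keeps its initial
component off the training subspace, then `v` must approach `vs`, and the conservation law forces
`(v₀ ⬝ᵥ vs)²` to approach `|vs|⁴`. -/
lemma tendsto_initial_head_sq {α : Type*} {l : Filter α} {k d : ℕ}
    {Bs : Matrix (Fin k) (Fin d) ℝ} {vs : Fin k → ℝ} (hBs : Bs * Bsᵀ = 1)
    {Q : Matrix (Fin d) (Fin d) ℝ} (hQ : Qᵀ = Q) {L : Matrix (Fin k) (Fin d) ℝ}
    (hL : L * (Q * Bsᵀ) = 1) {v₀ v : α → Fin k → ℝ} {C B : α → Matrix (Fin k) (Fin d) ℝ}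
    (hC : ∀ᶠ x in l, C x * (C x)ᵀ = 1)
    (hbal : ∀ᶠ x in l, Matrix.vecMulVec (v x) (v x) - B x * (B x)ᵀ =
      Matrix.vecMulVec (v₀ x) (v₀ x) - C x * (C x)ᵀ)
    (hfroz : ∀ᶠ x in l, B x * Q = C x * Q)
    (hClim : Tendsto C l (𝓝 Bs))
    (hfit : Tendsto (fun x => (B x)ᵀ *ᵥ v x) l (𝓝 (Bsᵀ *ᵥ vs))) :
    Tendsto (fun x => (v₀ x ⬝ᵥ vs) ^ 2) l (𝓝 ((vs ⬝ᵥ vs) ^ 2)) := by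
  have hv : Tendsto v l (𝓝 vs) := by
    refine tendsto_of_tendsto_mulVec (D := fun x => L * (Q * (C x)ᵀ)) ?_ ?_
    · rw [← hL]
      exact ((continuous_const.matrix_mul (continuous_const.matrix_mul
        (continuous_id.matrix_transpose))).tendsto Bs).comp hClim
    · have h := ((Continuous.matrix_mulVec (A := fun _ => L * Q) continuous_const
        continuous_id).tendsto (Bsᵀ *ᵥ vs)).comp hfit
      rw [id, Matrix.mulVec_mulVec, Matrix.mul_assoc, hL, Matrix.one_mulVec] at h
      refine h.congr' ?_
      filter_upwards [hfroz] with x hx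
      have hx' := congrArg Matrix.transpose hx
      rw [Matrix.transpose_mul, Matrix.transpose_mul, hQ] at hx'
      rw [Function.comp_apply, id, Matrix.mulVec_mulVec, Matrix.mul_assoc, hx']
  have hdot : Continuous fun y : Fin k → ℝ => y ⬝ᵥ y := continuous_id.dotProduct continuous_id
  have hdot' : Continuous fun y : Fin d → ℝ => y ⬝ᵥ y := continuous_id.dotProduct continuous_id
  -- the conservation law evaluated at `v`
  have h1 : Tendsto (fun x => (v₀ x ⬝ᵥ v x) ^ 2) l (𝓝 ((vs ⬝ᵥ vs) ^ 2)) := by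
    have h := ((((hdot.tendsto vs).comp hv).pow 2).sub ((hdot'.tendsto _).comp hfit)).add
      ((hdot.tendsto vs).comp hv)
    rw [mulVec_dotProduct, Matrix.transpose_transpose, Matrix.mulVec_mulVec, hBs,
      Matrix.one_mulVec, sub_add_cancel] at h
    refine h.congr' ?_
    filter_upwards [hC, hbal] with x hx hx'
    have := balanced_quadratic hx' hx (v x)
    simp only [Function.comp_apply]
    linarith
  -- the conservation law evaluated at `v₀` bounds `v₀`
  have h2 : ∀ᶠ x in l, v₀ x ⬝ᵥ v₀ x ≤ 2 + (vs ⬝ᵥ vs) ^ 2 := by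
    filter_upwards [hC, hbal, h1.eventually_le_const (lt_add_one _)] with x hx hx' hle
    have h := balanced_quadratic hx' hx (v₀ x)
    rw [dotProduct_comm (v x)] at h
    have h3 := zero_le_dotProduct_self ((B x)ᵀ *ᵥ v₀ x)
    by_contra! hlt
    nlinarith [sq_nonneg (vs ⬝ᵥ vs)]
  have h3 : Tendsto (fun x => (v₀ x ⬝ᵥ (vs - v x)) ^ 2) l (𝓝 0) := by
    have hz : Tendsto (fun x => (2 + (vs ⬝ᵥ vs) ^ 2) * ((vs - v x) ⬝ᵥ (vs - v x))) l (𝓝 0) := by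
      have h := ((hdot.tendsto _).comp (hv.const_sub vs)).const_mul (2 + (vs ⬝ᵥ vs) ^ 2)
      rwa [sub_self, zero_dotProduct, mul_zero] at h
    refine squeeze_zero' (Eventually.of_forall fun x => sq_nonneg _) ?_ hz
    filter_upwards [h2] with x hx
    exact (dotProduct_sq_le _ _).trans
      (mul_le_mul_of_nonneg_right hx (zero_le_dotProduct_self _))
  have h4 : Tendsto (fun x => (v₀ x ⬝ᵥ v x) * (v₀ x ⬝ᵥ (vs - v x))) l (𝓝 0) := by
    refine tendsto_zero_of_sq ?_
    have h := h1.mul h3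
    rw [mul_zero] at h
    exact h.congr fun x => (mul_pow _ _ 2).symm
  have h := (h1.add (h4.const_mul 2)).add h3
  rw [mul_zero, add_zero, add_zero] at h
  refine h.congr fun x => ?_
  rw [dotProduct_sub]
  ring

/-! ### Linear probing -/

/-- The solutions of `c' = -2 (lam c - β)` on `[0, ∞)` converge to a zero of the right-hand side; if
`lam = 0` this needs `β = 0`, and then the solutions are constant. -/
lemma exists_tendsto_of_linear_ode {c : ℝ → ℝ} {lam β : ℝ} (hlam : 0 ≤ lam)
    (hβ : lam = 0 → β = 0)
    (hc : ∀ t, 0 ≤ t → HasDerivWithinAt c (-(2 * (lam * c t - β))) (Set.Ici 0) t) :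
    ∃ γ, Tendsto c atTop (𝓝 γ) ∧ lam * γ = β := by
  rcases hlam.eq_or_lt with h0 | hpos
  · have hβ0 := hβ h0.symm
    refine ⟨c 0, tendsto_const_nhds.congr' ?_, by rw [← h0, hβ0, zero_mul]⟩
    filter_upwards [eventually_ge_atTop 0] with t ht
    exact (eq_of_hasDerivWithinAt_Ici_zero (fun s hs => (hc s hs).congr_deriv
      (by rw [← h0, hβ0]; ring)) ht).symm
  · refine ⟨β / lam, ?_, mul_div_cancel₀ _ hpos.ne'⟩
    have hE : ∀ s : ℝ, HasDerivAt (fun t => Real.exp (2 * lam * t))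
        (Real.exp (2 * lam * s) * (2 * lam)) s := fun s => by
      simpa using ((hasDerivAt_id s).const_mul (2 * lam)).exp
    have hconst : ∀ t, 0 ≤ t →
        Real.exp (2 * lam * t) * (c t - β / lam) = c 0 - β / lam := fun t ht => by
      have h := eq_of_hasDerivWithinAt_Ici_zero
        (f := fun t => Real.exp (2 * lam * t) * (c t - β / lam)) (fun s hs => ?_) ht
      · simpa using h
      · refine ((hE s).hasDerivWithinAt.mul ((hc s hs).sub_const (β / lam))).congr_deriv ?_
        field_simp
        ring
    have hlim : Tendsto (fun t => Real.exp (-(2 * lam * t)) * (c 0 - β / lam) + β / lam) atTop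
        (𝓝 (β / lam)) := by
      have h := ((Real.tendsto_exp_neg_atTop_nhds_zero.comp
        (tendsto_id.const_mul_atTop (by positivity : 0 < 2 * lam))).mul_const
          (c 0 - β / lam)).add_const (β / lam)
      rwa [zero_mul, zero_add] at h
    refine hlim.congr' ?_
    filter_upwards [eventually_ge_atTop 0] with t ht
    rw [← hconst t ht, ← mul_assoc, ← Real.exp_add, neg_add_cancel, Real.exp_zero, one_mul,
      sub_add_cancel]

/-- The linear probing flow converges, to a solution of the normal equations: in an eigenbasis of
`B₀ Xᵀ X B₀ᵀ` it decouples into scalar linear equations, and the right-hand side vanishes along the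
kernel. -/
lemma IsLinearProbing.exists_tendsto {n k d : ℕ} {X : Matrix (Fin n) (Fin d) ℝ} {Y : Fin n → ℝ}
    {v₀ : Fin k → ℝ} {B₀ : Matrix (Fin k) (Fin d) ℝ} {v : ℝ → Fin k → ℝ}
    (h : IsLinearProbing X Y v₀ B₀ v) :
    ∃ w, Tendsto v atTop (𝓝 w) ∧ B₀ *ᵥ residualGrad X Y (B₀ᵀ *ᵥ w) = 0 := by
  set M := X * B₀ᵀ with hM
  have hgrad : ∀ w, B₀ *ᵥ residualGrad X Y (B₀ᵀ *ᵥ w) = (Mᵀ * M) *ᵥ w - Mᵀ *ᵥ Y := fun w => by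
    rw [residualGrad, Matrix.mulVec_sub, Matrix.mulVec_sub, hM, Matrix.transpose_mul,
      Matrix.transpose_transpose]
    simp only [Matrix.mulVec_mulVec, Matrix.mul_assoc]
  have hpsd : (Mᵀ * M).PosSemidef := by
    simpa using Matrix.posSemidef_conjTranspose_mul_self M
  set U : Matrix (Fin k) (Fin k) ℝ := hpsd.isHermitian.eigenvectorUnitary.val with hU
  set lam := hpsd.isHermitian.eigenvalues with hlam
  have hUU : U * Uᵀ = 1 := by
    have := (Matrix.mem_unitaryGroup_iff).1 hpsd.isHermitian.eigenvectorUnitary.2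
    simpa [Matrix.star_eq_conjTranspose] using this
  have hUU' : Uᵀ * U = 1 := mul_eq_one_comm.1 hUU
  have hspec : Uᵀ * (Mᵀ * M) = Matrix.diagonal lam * Uᵀ := by
    have h1 : Mᵀ * M = U * Matrix.diagonal lam * Uᵀ := by
      have := hpsd.isHermitian.spectral_theorem
      rw [Unitary.conjStarAlgAut_apply] at this
      exact this
    rw [h1, ← Matrix.mul_assoc, ← Matrix.mul_assoc, hUU', Matrix.one_mul]
  have hβ : ∀ j, lam j = 0 → (Uᵀ *ᵥ (Mᵀ *ᵥ Y)) j = 0 := fun j hj => by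
    have h1 : (M * U)ᵀ * (M * U) = Matrix.diagonal lam := by
      rw [Matrix.transpose_mul, Matrix.mul_assoc, ← Matrix.mul_assoc Mᵀ, ← Matrix.mul_assoc,
        hspec, Matrix.mul_assoc, hUU', Matrix.mul_one]
    have h2 := congrFun (congrFun h1 j) j
    rw [Matrix.diagonal_apply_eq, hj, Matrix.mul_apply] at h2
    have h3 := (Finset.sum_eq_zero_iff_of_nonneg fun i _ => mul_self_nonneg ((M * U) i j)).1 h2
    rw [Matrix.mulVec_mulVec, ← Matrix.transpose_mul]
    change ∑ i, (M * U) i j * Y i = 0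
    refine Finset.sum_eq_zero fun i hi => ?_
    rw [mul_self_eq_zero.1 (h3 i hi), zero_mul]
  have hode : ∀ j t, 0 ≤ t → HasDerivWithinAt (fun s => (Uᵀ *ᵥ v s) j)
      (-(2 * (lam j * (Uᵀ *ᵥ v t) j - (Uᵀ *ᵥ (Mᵀ *ᵥ Y)) j))) (Set.Ici 0) t := fun j t ht => by
    refine (HasDerivWithinAt.fun_sum fun a (_ : a ∈ Finset.univ) =>
      (h.flow_head t ht a).const_mul (Uᵀ j a)).congr_deriv ?_
    change (Uᵀ *ᵥ (-gradHead X Y (v t) B₀)) j = _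
    rw [gradHead_eq, hgrad, Matrix.mulVec_neg, Matrix.mulVec_smul, Matrix.mulVec_sub,
      Matrix.mulVec_mulVec, hspec, ← Matrix.mulVec_mulVec, Pi.neg_apply, Pi.smul_apply,
      Pi.sub_apply, Matrix.mulVec_diagonal, smul_eq_mul]
  choose γ hγ hγ' using fun j =>
    exists_tendsto_of_linear_ode (hpsd.eigenvalues_nonneg j) (hβ j) (hode j)
  have hlim : Tendsto (fun t => Uᵀ *ᵥ v t) atTop (𝓝 γ) := tendsto_pi_nhds.2 hγ
  have hlim' := ((Continuous.matrix_mulVec (A := fun _ => U) continuous_const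
    continuous_id).tendsto γ).comp hlim
  refine ⟨U *ᵥ γ, hlim'.congr fun t => ?_, ?_⟩
  · rw [Function.comp_apply, id, Matrix.mulVec_mulVec, hUU, Matrix.one_mulVec]
  · have hzero : Uᵀ *ᵥ ((Mᵀ * M) *ᵥ (U *ᵥ γ) - Mᵀ *ᵥ Y) = 0 := by
      rw [Matrix.mulVec_sub, Matrix.mulVec_mulVec, hspec, Matrix.mulVec_mulVec, Matrix.mul_assoc,
        hUU', Matrix.mul_one, sub_eq_zero]
      funext j
      rw [Matrix.mulVec_diagonal, hγ']
    rw [hgrad, ← Matrix.one_mulVec ((Mᵀ * M) *ᵥ _ - _), ← hUU, ← Matrix.mulVec_mulVec, hzero,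
      Matrix.mulVec_zero]

/-! ### The out-of-distribution risk as a quadratic form -/

lemma integral_dotProduct_sq {d : ℕ} {P : Measure (Fin d → ℝ)}
    (hP : ∀ i, MemLp (fun x : Fin d → ℝ => x i) 2 P) (r : Fin d → ℝ) :
    ∫ x, (r ⬝ᵥ x) ^ 2 ∂P = r ⬝ᵥ (secondMoment P *ᵥ r) := by
  have hint : ∀ i j, Integrable (fun x : Fin d → ℝ => x i * x j) P := fun i j =>
    (hP i).integrable_mul (hP j)
  have h1 : ∀ x : Fin d → ℝ, (r ⬝ᵥ x) ^ 2 = ∑ i, ∑ j, r i * r j * (x i * x j) := fun x => by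
    rw [sq, dotProduct, Finset.sum_mul_sum]
    exact Finset.sum_congr rfl fun i _ => Finset.sum_congr rfl fun j _ => by ring
  simp_rw [h1]
  rw [integral_finsetSum _ fun i _ => integrable_finsetSum _ fun j _ => (hint i j).const_mul _]
  refine Finset.sum_congr rfl fun i _ => ?_
  rw [integral_finsetSum _ fun j _ => (hint i j).const_mul _, Matrix.mulVec, dotProduct,
    Finset.mul_sum]
  refine Finset.sum_congr rfl fun j _ => ?_
  rw [integral_const_mul, secondMoment, Matrix.of_apply]
  ring

lemma risk_eq {k d : ℕ} {P : Measure (Fin d → ℝ)}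
    (hP : ∀ i, MemLp (fun x : Fin d → ℝ => x i) 2 P) (vs : Fin k → ℝ)
    (Bs : Matrix (Fin k) (Fin d) ℝ) (v : Fin k → ℝ) (B : Matrix (Fin k) (Fin d) ℝ) :
    risk P vs Bs v B =
      (Bᵀ *ᵥ v - Bsᵀ *ᵥ vs) ⬝ᵥ (secondMoment P *ᵥ (Bᵀ *ᵥ v - Bsᵀ *ᵥ vs)) := by
  rw [← integral_dotProduct_sq hP, risk]
  simp only [sub_dotProduct, mulVec_dotProduct, Matrix.transpose_transpose]

lemma secondMoment_posSemidef {d : ℕ} {P : Measure (Fin d → ℝ)}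
    (hP : ∀ i, MemLp (fun x : Fin d → ℝ => x i) 2 P) : (secondMoment P).PosSemidef := by
  refine Matrix.posSemidef_iff_dotProduct_mulVec.2 ⟨?_, fun r => ?_⟩
  · ext i j
    simp [secondMoment, mul_comm]
  · rw [star_trivial, ← integral_dotProduct_sq hP]
    exact integral_nonneg fun x => sq_nonneg _

open scoped MatrixOrder in
/-- An invertible positive semidefinite quadratic form controls its argument. -/
lemma tendsto_zero_of_quadratic_form {α : Type*} {l : Filter α} {d : ℕ}
    {A : Matrix (Fin d) (Fin d) ℝ} (hA : A.PosSemidef) (hA' : IsUnit A) {r : α → Fin d → ℝ}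
    (h : Tendsto (fun x => r x ⬝ᵥ (A *ᵥ r x)) l (𝓝 0)) : Tendsto r l (𝓝 0) := by
  obtain ⟨C, hC⟩ := CStarAlgebra.nonneg_iff_eq_star_mul_self.1 hA.nonneg
  replace hC : A = Cᵀ * C := by simpa [Matrix.star_eq_conjTranspose] using hC
  have hCdet : IsUnit C.det := by
    rw [Matrix.isUnit_iff_isUnit_det, hC, Matrix.det_mul] at hA'
    exact isUnit_of_mul_isUnit_right hA'
  have hCr : Tendsto (fun x => C *ᵥ r x) l (𝓝 0) := by
    refine tendsto_pi_nhds.2 fun j => tendsto_zero_of_sq ?_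
    refine squeeze_zero (fun x => sq_nonneg _) (fun x => ?_) h
    rw [hC, ← Matrix.mulVec_mulVec, ← mulVec_dotProduct, sq]
    exact Finset.single_le_sum (f := fun i => (C *ᵥ r x) i * (C *ᵥ r x) i)
      (fun i _ => mul_self_nonneg _) (Finset.mem_univ j)
  have hcont : Continuous fun y : Fin d → ℝ => C⁻¹ *ᵥ y :=
    continuous_const.matrix_mulVec continuous_id
  have h' := (hcont.tendsto 0).comp hCr
  rw [Matrix.mulVec_zero] at h'
  refine h'.congr fun x => ?_
  rw [Function.comp_apply, Matrix.mulVec_mulVec, Matrix.nonsing_inv_mul _ hCdet,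
    Matrix.one_mulVec]

/-! ### Random design matrices -/

/-- At most `k` independent vectors of `ℝ^k` are almost surely linearly independent if their law
charges no proper subspace: given the others, the first one almost surely avoids their span. -/
lemma ae_linearIndependent_pi {k : ℕ} {ν : Measure (Fin k → ℝ)} [IsProbabilityMeasure ν]
    (hν : ∀ W : Submodule ℝ (Fin k → ℝ), W ≠ ⊤ → ν W = 0) {r : ℕ} (hr : r ≤ k) :
    ∀ᵐ Z ∂Measure.pi (fun _ : Fin r => ν), LinearIndependent ℝ Z := by
  induction r with
  | zero => exact Eventually.of_forall fun Z => linearIndependent_empty_type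
  | succ r ih =>
    have hmp := measurePreserving_piFinSuccAbove (fun _ : Fin (r + 1) => ν) 0
    have hmeas : MeasurableSet {p : (Fin k → ℝ) × (Fin r → Fin k → ℝ) |
        LinearIndependent ℝ (Fin.cons p.1 p.2 : Fin (r + 1) → Fin k → ℝ)} := by
      refine (isOpen_setOfPred_linearIndependent.preimage ?_).measurableSet
      exact Continuous.finCons continuous_fst continuous_snd
    have hprod : ∀ᵐ p ∂ν.prod (Measure.pi fun _ : Fin r => ν),
        LinearIndependent ℝ (Fin.cons p.1 p.2 : Fin (r + 1) → Fin k → ℝ) := by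
      -- fix the last `r` vectors first, so that their span is a fixed subspace for the first one
      rw [Measure.ae_prod_iff_ae_ae hmeas, Measure.ae_ae_comm hmeas]
      filter_upwards [ih (by omega)] with Z hZ
      have hW : Submodule.span ℝ (Set.range Z) ≠ ⊤ := fun htop => by
        have h1 : Module.finrank ℝ (Submodule.span ℝ (Set.range Z)) ≤ Fintype.card (Fin r) :=
          finrank_range_le_card Z
        rw [htop, finrank_top, Module.finrank_fin_fun, Fintype.card_fin] at h1
        omega
      have := hν _ hW
      refine (measure_eq_zero_iff_ae_notMem.1 this).mono fun x hx => ?_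
      exact linearIndependent_finCons.2 ⟨hZ, hx⟩
    refine (hmp.quasiMeasurePreserving.ae hprod).mono fun Z hZ => ?_
    exact Fin.cons_self_tail Z ▸ hZ

lemma submodule_null_of_map {m k : ℕ} {Pz : Measure (Fin m → ℝ)} (hPz : Pz ≪ volume)
    {G : Matrix (Fin k) (Fin m) ℝ} (hG : Function.Surjective G.mulVec)
    {W : Submodule ℝ (Fin k → ℝ)} (hW : W ≠ ⊤) : Pz.map (fun z => G *ᵥ z) W = 0 := by
  have hmeas : Measurable fun z : Fin m → ℝ => G *ᵥ z :=
    (continuous_const.matrix_mulVec continuous_id).measurable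
  rw [Measure.map_apply hmeas (Submodule.closed_of_finiteDimensional W).measurableSet]
  refine hPz (Measure.addHaar_submodule volume (W.comap G.mulVecLin) fun htop => hW ?_)
  refine Submodule.eq_top_iff'.2 fun y => ?_
  obtain ⟨z, rfl⟩ := hG y
  exact (htop ▸ Submodule.mem_top : z ∈ W.comap G.mulVecLin)

/-- Almost surely the training inputs determine the coefficients of every model with extractor
`Bs`. -/
lemma ae_mulVec_injective {n k d : ℕ} (hkn : k ≤ n) {Bs : Matrix (Fin k) (Fin d) ℝ}
    {Pid : Measure (Fin d → ℝ)} [IsProbabilityMeasure Pid]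
    (hPid : ∀ W : Submodule ℝ (Fin k → ℝ), W ≠ ⊤ → Pid.map (fun x => Bs *ᵥ x) W = 0)
    {Ω : Type*} [MeasurableSpace Ω] {P : Measure Ω} [IsProbabilityMeasure P]
    {X : Ω → Matrix (Fin n) (Fin d) ℝ} (hX : ∀ j, HasLaw (fun ω => X ω j) Pid P)
    (hind : iIndepFun (fun j ω => X ω j) P) :
    ∀ᵐ ω ∂P, ∀ u, (X ω * Bsᵀ) *ᵥ u = 0 → u = 0 := by
  have hmeas : Measurable fun x : Fin d → ℝ => Bs *ᵥ x :=
    (continuous_const.matrix_mulVec continuous_id).measurable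
  have hlaw : ∀ j : Fin k, P.map (fun ω => Bs *ᵥ X ω (Fin.castLE hkn j)) =
      Pid.map (fun x => Bs *ᵥ x) := fun j => by
    rw [← (hX (Fin.castLE hkn j)).map_eq, AEMeasurable.map_map_of_aemeasurable
      hmeas.aemeasurable (hX _).aemeasurable]
    rfl
  have haem : ∀ j : Fin k, AEMeasurable (fun ω => Bs *ᵥ X ω (Fin.castLE hkn j)) P := fun j =>
    hmeas.comp_aemeasurable (hX _).aemeasurable
  have hind' : iIndepFun (fun (j : Fin k) ω => Bs *ᵥ X ω (Fin.castLE hkn j)) P :=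
    (hind.precomp (Fin.castLE_injective hkn)).comp _ fun _ => hmeas
  have hpi := (iIndepFun_iff_map_fun_eq_pi_map haem).1 hind'
  simp only [hlaw] at hpi
  have : IsProbabilityMeasure (Pid.map fun x => Bs *ᵥ x) :=
    Measure.isProbabilityMeasure_map hmeas.aemeasurable
  have hli := ae_linearIndependent_pi hPid le_rfl
  rw [← hpi] at hli
  refine (ae_of_ae_map (aemeasurable_pi_lambda _ haem) hli).mono fun ω hω u hu => ?_
  set Y : Matrix (Fin k) (Fin k) ℝ := Matrix.of fun j => Bs *ᵥ X ω (Fin.castLE hkn j) with hY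
  have hunit : IsUnit Y := Matrix.linearIndependent_rows_iff_isUnit.1 hω
  refine Matrix.mulVec_injective_iff_isUnit.2 hunit ?_
  rw [Matrix.mulVec_zero]
  funext j
  have h1 := congrFun hu (Fin.castLE hkn j)
  rw [← Matrix.mulVec_mulVec] at h1
  rw [Pi.zero_apply] at h1 ⊢
  rw [← h1]
  change (Bs *ᵥ X ω (Fin.castLE hkn j)) ⬝ᵥ u = X ω (Fin.castLE hkn j) ⬝ᵥ (Bsᵀ *ᵥ u)
  exact mulVec_dotProduct _ _ _

/-! ### Gaussian heads -/

lemma isoGaussian_map_dotProduct {k : ℕ} (σsq : ℝ≥0) (u : Fin k → ℝ) :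
    (isoGaussian k σsq).map (fun v => v ⬝ᵥ u) = gaussianReal 0 (σsq * (u ⬝ᵥ u).toNNReal) := by
  have hmeas : Measurable fun v : Fin k → ℝ => v ⬝ᵥ u :=
    (continuous_id.dotProduct continuous_const).measurable
  have : IsProbabilityMeasure (isoGaussian k σsq) := by unfold isoGaussian; infer_instance
  have := Measure.isProbabilityMeasure_map (μ := isoGaussian k σsq) hmeas.aemeasurable
  refine Measure.ext_of_charFun (funext fun t => ?_)
  rw [charFun_apply_real, integral_map hmeas.aemeasurable (by fun_prop), isoGaussian]
  have h1 : ∀ v : Fin k → ℝ, Complex.exp (t * ((v ⬝ᵥ u : ℝ) : ℂ) * Complex.I) =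
      ∏ a, Complex.exp (((t * u a : ℝ) : ℂ) * (v a : ℂ) * Complex.I) := fun v => by
    rw [← Complex.exp_sum, dotProduct]
    push_cast
    rw [Finset.mul_sum, Finset.sum_mul]
    congr 1
    exact Finset.sum_congr rfl fun a _ => by ring
  simp_rw [h1]
  rw [integral_fintype_prod_eq_prod
    (f := fun a (x : ℝ) => Complex.exp (((t * u a : ℝ) : ℂ) * (x : ℂ) * Complex.I))]
  simp_rw [← charFun_apply_real, charFun_gaussianReal]
  rw [← Complex.exp_sum]
  congr 1
  simp only [Complex.ofReal_zero, mul_zero, zero_mul, zero_sub, NNReal.coe_mul,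
    Real.coe_toNNReal _ (zero_le_dotProduct_self u)]
  rw [Finset.sum_neg_distrib, dotProduct]
  push_cast
  rw [Finset.mul_sum, Finset.sum_mul, Finset.sum_div]
  congr 1
  exact Finset.sum_congr rfl fun a _ => by ring

/-- The level `c` is positive, so this includes the degenerate Gaussian, the point mass at `0`. -/
lemma gaussianReal_sq_eq_null (τ : ℝ≥0) {c : ℝ} (hc : 0 < c) :
    gaussianReal 0 τ {x | x ^ 2 = c} = 0 := by
  by_cases hτ : τ = 0
  · rw [hτ, gaussianReal_zero_var, Measure.dirac_apply' _
      (measurableSet_eq_fun (by fun_prop) (by fun_prop))]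
    simp [hc.ne]
  · have := nullSingletonClass_gaussianReal (μ := 0) hτ
    refine Set.Finite.measure_zero ?_ _
    refine (Set.toFinite {Real.sqrt c, -Real.sqrt c}).subset fun x hx => ?_
    have hx' : x ^ 2 = Real.sqrt c ^ 2 := by rw [Real.sq_sqrt hc.le]; exact hx
    simpa using sq_eq_sq_iff_eq_or_eq_neg.1 hx'

lemma exists_gaussianReal_sq_near_le (τ : ℝ≥0) {c : ℝ} (hc : 0 < c) {η : ℝ≥0∞} (hη : 0 < η) :
    ∃ δ : ℝ, 0 < δ ∧ gaussianReal 0 τ {x | |x ^ 2 - c| < δ} ≤ η := by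
  have hmeas : ∀ δ : ℝ, MeasurableSet {x : ℝ | |x ^ 2 - c| < δ} := fun δ =>
    measurableSet_lt (by fun_prop) measurable_const
  have h := tendsto_measure_iInter_atTop (μ := gaussianReal 0 τ)
    (s := fun n : ℕ => {x : ℝ | |x ^ 2 - c| < 1 / ((n : ℝ) + 1)})
    (fun n => (hmeas _).nullMeasurableSet)
    (fun a b hab => Set.ofPred_subset_ofPred.2 fun x hx =>
      hx.trans_le (Nat.one_div_le_one_div hab))
    ⟨0, measure_ne_top _ _⟩
  have h0 : gaussianReal 0 τ (⋂ n : ℕ, {x : ℝ | |x ^ 2 - c| < 1 / ((n : ℝ) + 1)}) = 0 := by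
    refine measure_mono_null (fun x hx => ?_) (gaussianReal_sq_eq_null τ hc)
    by_contra hne
    obtain ⟨n, hn⟩ := exists_nat_one_div_lt (abs_pos.2 (sub_ne_zero.2 hne))
    exact lt_asymm hn (Set.mem_iInter.1 hx n)
  rw [h0] at h
  obtain ⟨n, hn⟩ := (h.eventually_le_const hη).exists
  exact ⟨_, Nat.one_div_pos_of_nat, hn⟩

/-! ### Linear probing on random data -/

/-- The Gram matrix `C Xᵀ X Cᵀ` of the features. -/
def featureGram {n k d : ℕ} (X : Matrix (Fin n) (Fin d) ℝ) (C : Matrix (Fin k) (Fin d) ℝ) :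
    Matrix (Fin k) (Fin k) ℝ :=
  (X * Cᵀ)ᵀ * (X * Cᵀ)

/-- The least squares head for the labels `X y` and the extractor `C`, by Cramer's rule. It is a
junk value when the Gram matrix is singular. -/
noncomputable def leastSquaresHead {n k d : ℕ} (y : Fin d → ℝ) (X : Matrix (Fin n) (Fin d) ℝ)
    (C : Matrix (Fin k) (Fin d) ℝ) : Fin k → ℝ :=
  (featureGram X C).det⁻¹ • ((featureGram X C).adjugate *ᵥ ((X * Cᵀ)ᵀ *ᵥ (X *ᵥ y)))

lemma eq_leastSquaresHead {n k d : ℕ} {y : Fin d → ℝ} {X : Matrix (Fin n) (Fin d) ℝ}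
    {C : Matrix (Fin k) (Fin d) ℝ} (hdet : (featureGram X C).det ≠ 0) {w : Fin k → ℝ}
    (hw : C *ᵥ residualGrad X (X *ᵥ y) (Cᵀ *ᵥ w) = 0) : w = leastSquaresHead y X C := by
  have h1 : (X * Cᵀ)ᵀ *ᵥ (X *ᵥ y) = featureGram X C *ᵥ w := by
    rw [residualGrad, Matrix.mulVec_sub, Matrix.mulVec_sub, sub_eq_zero] at hw
    rw [featureGram, Matrix.transpose_mul, Matrix.transpose_transpose]
    simp only [← Matrix.mulVec_mulVec]
    exact hw.symm
  rw [leastSquaresHead, h1, Matrix.mulVec_mulVec, Matrix.adjugate_mul, Matrix.smul_mulVec,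
    Matrix.one_mulVec, inv_smul_smul₀ hdet]

lemma featureGram_det_ne_zero {n k d : ℕ} {X : Matrix (Fin n) (Fin d) ℝ}
    {C : Matrix (Fin k) (Fin d) ℝ} (h : ∀ u, (X * Cᵀ) *ᵥ u = 0 → u = 0) :
    (featureGram X C).det ≠ 0 := by
  rw [← isUnit_iff_ne_zero, ← Matrix.isUnit_iff_isUnit_det, ← Matrix.mulVec_injective_iff_isUnit]
  refine (injective_iff_map_eq_zero (featureGram X C).mulVecLin).2 fun u hu => h u ?_
  have hu' : (X * Cᵀ)ᵀ *ᵥ ((X * Cᵀ) *ᵥ u) = 0 := by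
    rw [Matrix.mulVec_mulVec]
    exact hu
  rw [← dotProduct_self_eq_zero, mulVec_dotProduct, hu', dotProduct_zero]

lemma continuous_featureGram {n k d : ℕ} : Continuous
    fun p : Matrix (Fin n) (Fin d) ℝ × Matrix (Fin k) (Fin d) ℝ => featureGram p.1 p.2 := by
  unfold featureGram
  fun_prop

lemma continuous_leastSquares_numerator {n k d : ℕ} (y : Fin d → ℝ) : Continuous
    fun p : Matrix (Fin n) (Fin d) ℝ × Matrix (Fin k) (Fin d) ℝ =>
      (featureGram p.1 p.2).adjugate *ᵥ ((p.1 * p.2ᵀ)ᵀ *ᵥ (p.1 *ᵥ y)) := by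
  have := continuous_featureGram (n := n) (k := k) (d := d)
  fun_prop

lemma tendsto_leastSquaresHead {n k d : ℕ} {X : Matrix (Fin n) (Fin d) ℝ}
    {Bs : Matrix (Fin k) (Fin d) ℝ} (hdet : (featureGram X Bs).det ≠ 0) (vs : Fin k → ℝ)
    {C : ℕ → Matrix (Fin k) (Fin d) ℝ} (hC : Tendsto C atTop (𝓝 Bs)) :
    Tendsto (fun i => leastSquaresHead (Bsᵀ *ᵥ vs) X (C i)) atTop (𝓝 vs) := by
  have hp : Tendsto (fun i => (X, C i)) atTop (𝓝 (X, Bs)) := tendsto_const_nhds.prodMk_nhds hC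
  have h1 := ((continuous_featureGram.matrix_det.tendsto (X, Bs)).comp hp).inv₀ hdet
  have h2 := ((continuous_leastSquares_numerator (Bsᵀ *ᵥ vs)).tendsto (X, Bs)).comp hp
  have hvs : vs = leastSquaresHead (Bsᵀ *ᵥ vs) X Bs := eq_leastSquaresHead hdet (by
    rw [residualGrad, sub_self, Matrix.mulVec_zero, Matrix.mulVec_zero])
  have h := h1.smul h2
  conv_rhs => rw [hvs]
  exact h

lemma continuous_risk {k d : ℕ} {P : Measure (Fin d → ℝ)}
    (hP : ∀ i, MemLp (fun x : Fin d → ℝ => x i) 2 P) (vs : Fin k → ℝ)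
    (Bs : Matrix (Fin k) (Fin d) ℝ) :
    Continuous fun p : (Fin k → ℝ) × Matrix (Fin k) (Fin d) ℝ => risk P vs Bs p.1 p.2 := by
  have hres : Continuous fun p : (Fin k → ℝ) × Matrix (Fin k) (Fin d) ℝ =>
      p.2ᵀ *ᵥ p.1 - Bsᵀ *ᵥ vs :=
    (continuous_snd.matrix_transpose.matrix_mulVec continuous_fst).sub continuous_const
  refine (hres.dotProduct (Continuous.matrix_mulVec (A := fun _ => secondMoment P)
    continuous_const hres)).congr fun p => ?_
  exact (risk_eq hP vs Bs p.1 p.2).symm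

/-- The design matrices for which the Gram matrix of the features is singular or the least squares
head has risk at least `ε`. -/
def badDesign {n k d : ℕ} (P : Measure (Fin d → ℝ)) (vs : Fin k → ℝ)
    (Bs C : Matrix (Fin k) (Fin d) ℝ) (ε : ℝ) : Set (Fin n → Fin d → ℝ) :=
  {x | (featureGram (Matrix.of x) C).det = 0 ∨
    ε ≤ risk P vs Bs (leastSquaresHead (Bsᵀ *ᵥ vs) (Matrix.of x) C) C}

lemma measurableSet_badDesign {n k d : ℕ} {P : Measure (Fin d → ℝ)}
    (hP : ∀ i, MemLp (fun x : Fin d → ℝ => x i) 2 P) (vs : Fin k → ℝ)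
    (Bs C : Matrix (Fin k) (Fin d) ℝ) (ε : ℝ) :
    MeasurableSet (badDesign (n := n) P vs Bs C ε) := by
  have hpair : Continuous fun x : Fin n → Fin d → ℝ => (Matrix.of x, C) :=
    Continuous.prodMk continuous_id continuous_const
  have hdet : Measurable fun x : Fin n → Fin d → ℝ => (featureGram (Matrix.of x) C).det :=
    (continuous_featureGram.comp hpair).matrix_det.measurable
  have hhead : Measurable fun x : Fin n → Fin d → ℝ =>
      leastSquaresHead (Bsᵀ *ᵥ vs) (Matrix.of x) C :=
    hdet.inv.smul ((continuous_leastSquares_numerator (Bsᵀ *ᵥ vs)).comp hpair).measurable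
  have hrisk : Measurable fun w : Fin k → ℝ => risk P vs Bs w C :=
    ((continuous_risk hP vs Bs).comp (Continuous.prodMk continuous_id continuous_const)).measurable
  exact (measurableSet_eq_fun hdet measurable_const).union
    (measurableSet_le measurable_const (hrisk.comp hhead))

lemma eventually_notMem_badDesign {n k d : ℕ} {P : Measure (Fin d → ℝ)}
    (hP : ∀ i, MemLp (fun x : Fin d → ℝ => x i) 2 P) {vs : Fin k → ℝ}
    {Bs : Matrix (Fin k) (Fin d) ℝ} {X : Matrix (Fin n) (Fin d) ℝ}
    (hdet : (featureGram X Bs).det ≠ 0) {C : ℕ → Matrix (Fin k) (Fin d) ℝ}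
    (hC : Tendsto C atTop (𝓝 Bs)) {ε : ℝ} (hε : 0 < ε) :
    ∀ᶠ i in atTop, ¬ ((featureGram X (C i)).det = 0 ∨
      ε ≤ risk P vs Bs (leastSquaresHead (Bsᵀ *ᵥ vs) X (C i)) (C i)) := by
  have hdetC : Tendsto (fun i => (featureGram X (C i)).det) atTop (𝓝 (featureGram X Bs).det) := by
    have hpair : Tendsto (fun i => (X, C i)) atTop (𝓝 (X, Bs)) :=
      tendsto_const_nhds.prodMk_nhds hC
    have h := (continuous_featureGram.matrix_det.tendsto (X, Bs)).comp hpair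
    simpa only [Function.comp_def] using h
  have hrisk : Tendsto (fun i => risk P vs Bs (leastSquaresHead (Bsᵀ *ᵥ vs) X (C i)) (C i)) atTop
      (𝓝 (risk P vs Bs vs Bs)) := by
    have hpair := (tendsto_leastSquaresHead hdet vs hC).prodMk_nhds hC
    have h := ((continuous_risk hP vs Bs).tendsto (vs, Bs)).comp hpair
    simpa only [Function.comp_def] using h
  rw [risk_eq hP, sub_self, zero_dotProduct] at hrisk
  filter_upwards [hdetC.eventually_ne hdet, hrisk.eventually_lt_const hε] with i h1 h2
  exact not_or.2 ⟨h1, not_le.2 h2⟩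

/-- The risk of linear probing tends to zero in probability as the extractor approaches `Bs`. The
trajectories are not assumed measurable, so the bad event is phrased through the solutions `w` of
the normal equations and covered by measurable events in terms of the design matrix. -/
lemma tendsto_measure_linearProbing {n k d : ℕ} {Pood : Measure (Fin d → ℝ)}
    (hmoment : ∀ i, MemLp (fun x : Fin d → ℝ => x i) 2 Pood)
    {Bs : Matrix (Fin k) (Fin d) ℝ} {vs : Fin k → ℝ}
    {Ω : Type*} [MeasurableSpace Ω] {P : Measure Ω} [IsProbabilityMeasure P]
    {X : Ω → Matrix (Fin n) (Fin d) ℝ} (hX : ∀ j, AEMeasurable (fun ω => X ω j) P)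
    (hinj : ∀ᵐ ω ∂P, ∀ u, (X ω * Bsᵀ) *ᵥ u = 0 → u = 0)
    {C : ℕ → Matrix (Fin k) (Fin d) ℝ} (hC : Tendsto C atTop (𝓝 Bs)) {ε : ℝ} (hε : 0 < ε) :
    Tendsto (fun i => P {ω | ∃ w,
      C i *ᵥ residualGrad (X ω) (X ω *ᵥ (Bsᵀ *ᵥ vs)) ((C i)ᵀ *ᵥ w) = 0 ∧
        ε ≤ risk Pood vs Bs w (C i)}) atTop (𝓝 0) := by
  have hXm : AEMeasurable (β := Fin n → Fin d → ℝ) X P := aemeasurable_pi_lambda _ hX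
  obtain ⟨X', hX', hXX'⟩ := hXm
  have hlim : Tendsto (fun i => P (X' ⁻¹' badDesign Pood vs Bs (C i) ε)) atTop (𝓝 0) := by
    rw [← measure_empty (μ := P)]
    refine tendsto_measure_of_ae_tendsto_indicator_of_isFiniteMeasure atTop
      MeasurableSet.empty (fun i => hX' (measurableSet_badDesign hmoment vs Bs (C i) ε)) ?_
    filter_upwards [hXX', hinj] with ω hω hinjω
    filter_upwards [eventually_notMem_badDesign hmoment (featureGram_det_ne_zero hinjω) hC hε]
      with i hi
    refine iff_of_false ?_ (Set.notMem_empty _)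
    rw [Set.mem_preimage, ← hω]
    exact hi
  refine tendsto_of_tendsto_of_tendsto_of_le_of_le tendsto_const_nhds hlim
    (fun i => zero_le) fun i => ?_
  refine measure_mono_ae ?_
  filter_upwards [hXX'] with ω hω
  rintro ⟨w, hw, hεw⟩
  change X' ω ∈ badDesign Pood vs Bs (C i) ε
  rw [← hω]
  by_cases hdet : (featureGram (X ω) (C i)).det = 0
  · exact Or.inl hdet
  · rw [eq_leastSquaresHead hdet hw] at hεw
    exact Or.inr hεw

/-! ### Alignment of the extractors -/

lemma abs_apply_le_spectralNorm2 {k d : ℕ} (A : Matrix (Fin k) (Fin d) ℝ) (a : Fin k)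
    (l : Fin d) : |A a l| ≤ spectralNorm2 A := by
  have h := (Matrix.toEuclideanLin A).toContinuousLinearMap.le_opNorm (EuclideanSpace.single l 1)
  rw [PiLp.norm_single, norm_one, mul_one] at h
  refine le_trans ?_ h
  refine le_trans (le_of_eq ?_) (PiLp.norm_apply_le _ a)
  simp [Matrix.toEuclideanLin, Matrix.toLpLin_apply]

/-- Rotating the extractors by nearly optimal orthogonal matrices makes them converge to `Bs`. -/
lemma exists_rotations {k d : ℕ} {Bs : Matrix (Fin k) (Fin d) ℝ}
    {B₀ : ℕ → Matrix (Fin k) (Fin d) ℝ}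
    (hlim : Tendsto (fun i => extractorDist (B₀ i) Bs) atTop (𝓝 0)) :
    ∃ U : ℕ → Matrix (Fin k) (Fin k) ℝ, (∀ i, U i * (U i)ᵀ = 1) ∧
      Tendsto (fun i => (U i)ᵀ * B₀ i) atTop (𝓝 Bs) := by
  have hex : ∀ i : ℕ, ∃ U : Matrix.orthogonalGroup (Fin k) ℝ,
      spectralNorm2 (B₀ i - U.val * Bs) < extractorDist (B₀ i) Bs + 1 / ((i : ℝ) + 1) :=
    fun i => exists_lt_of_ciInf_lt (lt_add_of_pos_right _ Nat.one_div_pos_of_nat)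
  choose U hU using hex
  have hUU : ∀ i, (U i).val * (U i).valᵀ = 1 := fun i =>
    (Matrix.mem_orthogonalGroup_iff _ _).1 (U i).2
  refine ⟨fun i => (U i).val, hUU, ?_⟩
  have hnorm : Tendsto (fun i => (k : ℝ) * (extractorDist (B₀ i) Bs + 1 / ((i : ℝ) + 1))) atTop
      (𝓝 0) := by
    have h := (hlim.add tendsto_one_div_add_atTop_nhds_zero_nat).const_mul (k : ℝ)
    rwa [add_zero, mul_zero] at h
  refine tendsto_pi_nhds.2 fun a => tendsto_pi_nhds.2 fun l => ?_
  rw [tendsto_iff_dist_tendsto_zero]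
  refine squeeze_zero (fun i => dist_nonneg) (fun i => ?_) hnorm
  have h1 : ((U i).valᵀ * B₀ i) a l - Bs a l =
      ∑ b, (U i).val b a * (B₀ i - (U i).val * Bs) b l := by
    change ((U i).valᵀ * B₀ i - Bs) a l = ((U i).valᵀ * (B₀ i - (U i).val * Bs)) a l
    rw [Matrix.mul_sub, ← Matrix.mul_assoc, mul_eq_one_comm.1 (hUU i), Matrix.one_mul]
  rw [Real.dist_eq, h1]
  refine (Finset.abs_sum_le_sum_abs _ _).trans ?_
  have h2 : ∀ b ∈ Finset.univ, |(U i).val b a * (B₀ i - (U i).val * Bs) b l| ≤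
      extractorDist (B₀ i) Bs + 1 / ((i : ℝ) + 1) := fun b _ => by
    rw [abs_mul]
    refine (mul_le_mul (entry_norm_bound_of_unitary (U i).2 b a)
      (abs_apply_le_spectralNorm2 _ b l) (abs_nonneg _) zero_le_one).trans ?_
    rw [one_mul]
    exact (hU i).le
  refine (Finset.sum_le_sum h2).trans (le_of_eq ?_)
  rw [Finset.sum_const, Finset.card_univ, Fintype.card_fin, nsmul_eq_mul]

/-- A rotation of the features, compensated in the head, leaves the model unchanged. -/
lemma transpose_rotate_mulVec {k d : ℕ} {U : Matrix (Fin k) (Fin k) ℝ} (hU : U * Uᵀ = 1)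
    (B : Matrix (Fin k) (Fin d) ℝ) (v : Fin k → ℝ) : (Uᵀ * B)ᵀ *ᵥ (Uᵀ *ᵥ v) = Bᵀ *ᵥ v := by
  rw [Matrix.transpose_mul, Matrix.transpose_transpose, Matrix.mulVec_mulVec, Matrix.mul_assoc, hU,
    Matrix.mul_one]

lemma risk_rotate {k d : ℕ} {P : Measure (Fin d → ℝ)}
    (hP : ∀ i, MemLp (fun x : Fin d → ℝ => x i) 2 P) (vs : Fin k → ℝ)
    (Bs : Matrix (Fin k) (Fin d) ℝ) (v : Fin k → ℝ) (B : Matrix (Fin k) (Fin d) ℝ)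
    {U : Matrix (Fin k) (Fin k) ℝ} (hU : U * Uᵀ = 1) :
    risk P vs Bs (Uᵀ *ᵥ v) (Uᵀ * B) = risk P vs Bs v B := by
  rw [risk_eq hP, risk_eq hP, transpose_rotate_mulVec hU]

/-! ### Fine-tuning from a random head -/

lemma risk_nonneg {k d : ℕ} (P : Measure (Fin d → ℝ)) (vs : Fin k → ℝ)
    (Bs : Matrix (Fin k) (Fin d) ℝ) (v : Fin k → ℝ) (B : Matrix (Fin k) (Fin d) ℝ) :
    0 ≤ risk P vs Bs v B :=
  integral_nonneg fun _ => sq_nonneg _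

/-- Whenever the training inputs are orthogonal to the range of `Q` and the risk of fine-tuning gets
below some threshold at some time, the initial head lies in a thin neighbourhood of the two
hyperplanes `(v₀ ⬝ᵥ U vs)² = |vs|⁴`. The threshold depends neither on the trajectory nor, for large
`i`, on the extractor. -/
lemma exists_infRisk_threshold {n k d : ℕ} {Pood : Measure (Fin d → ℝ)}
    (hmoment : ∀ i, MemLp (fun x : Fin d → ℝ => x i) 2 Pood)
    (hinv : IsUnit (secondMoment Pood)) {Bs : Matrix (Fin k) (Fin d) ℝ} {vs : Fin k → ℝ}
    (hBs : Bs * Bsᵀ = 1) {Q : Matrix (Fin d) (Fin d) ℝ} (hQ : Qᵀ = Q)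
    {L : Matrix (Fin k) (Fin d) ℝ} (hL : L * (Q * Bsᵀ) = 1)
    {B₀ : ℕ → Matrix (Fin k) (Fin d) ℝ} (hB₀ : ∀ i, B₀ i * (B₀ i)ᵀ = 1)
    {U : ℕ → Matrix (Fin k) (Fin k) ℝ} (hU : ∀ i, U i * (U i)ᵀ = 1)
    (hlim : Tendsto (fun i => (U i)ᵀ * B₀ i) atTop (𝓝 Bs))
    {Ω : Type*} {X : Ω → Matrix (Fin n) (Fin d) ℝ} {Y : Ω → Fin n → ℝ} {v₀ : Ω → Fin k → ℝ}
    {v : ℕ → Ω → ℝ → Fin k → ℝ} {B : ℕ → Ω → ℝ → Matrix (Fin k) (Fin d) ℝ}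
    (hft : ∀ i ω, IsFineTuning (X ω) (Y ω) (v₀ ω) (B₀ i) (v i ω) (B i ω))
    {δ : ℝ} (hδ : 0 < δ) :
    ∃ ρ : ℝ, 0 < ρ ∧ ∀ᶠ i in atTop, ∀ ω, X ω * Q = 0 →
      infRisk Pood vs Bs (v i ω) (B i ω) < ρ →
        |(v₀ ω ⬝ᵥ (U i *ᵥ vs)) ^ 2 - (vs ⬝ᵥ vs) ^ 2| < δ := by
  -- all triples of an index, an outcome and a time, along growing indices and vanishing risk
  let R : ℕ × Ω × ℝ → ℝ := fun x => risk Pood vs Bs (v x.1 x.2.1 x.2.2) (B x.1 x.2.1 x.2.2)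
  let G : Set (ℕ × Ω × ℝ) := {x | X x.2.1 * Q = 0 ∧ 0 ≤ x.2.2}
  let l : Filter (ℕ × Ω × ℝ) := (comap Prod.fst atTop ⊓ comap R (𝓝 0)) ⊓ 𝓟 G
  have hl1 : Tendsto (fun x : ℕ × Ω × ℝ => x.1) l atTop :=
    tendsto_comap.mono_left (inf_le_left.trans inf_le_left)
  have hl2 : Tendsto R l (𝓝 0) := tendsto_comap.mono_left (inf_le_left.trans inf_le_right)
  have hl3 : ∀ᶠ x in l, x ∈ G := Filter.mem_inf_of_right (mem_principal_self G)
  have hU' : ∀ i, (U i)ᵀ * U i = 1 := fun i => mul_eq_one_comm.1 (hU i)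
  have key := tendsto_initial_head_sq (l := l) (v₀ := fun x => (U x.1)ᵀ *ᵥ v₀ x.2.1)
    (v := fun x => (U x.1)ᵀ *ᵥ v x.1 x.2.1 x.2.2) (C := fun x => (U x.1)ᵀ * B₀ x.1)
    (B := fun x => (U x.1)ᵀ * B x.1 x.2.1 x.2.2) (vs := vs) hBs hQ hL ?_ ?_ ?_ (hlim.comp hl1) ?_
  · have hev : ∀ᶠ x in l, |(v₀ x.2.1 ⬝ᵥ (U x.1 *ᵥ vs)) ^ 2 - (vs ⬝ᵥ vs) ^ 2| < δ := by
      filter_upwards [key.eventually (eventually_abs_sub_lt _ hδ)] with x hx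
      rwa [mulVec_dotProduct, Matrix.transpose_transpose] at hx
    obtain ⟨⟨N, ρ⟩, ⟨-, hρ⟩, h⟩ := (((atTop_basis.comap Prod.fst).inf
      ((nhds_basis_abs_sub_lt (0 : ℝ)).comap R)).inf_principal G).eventually_iff.1 hev
    refine ⟨ρ, hρ, ?_⟩
    filter_upwards [eventually_ge_atTop N] with i hi ω hω hinf
    obtain ⟨t, ht⟩ := exists_lt_of_ciInf_lt hinf
    refine @h (i, ω, t.1) ⟨⟨hi, ?_⟩, hω, t.2⟩
    change |R (i, ω, t.1) - 0| < ρ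
    rw [sub_zero, abs_of_nonneg (risk_nonneg _ _ _ _ _)]
    exact ht
  · refine Eventually.of_forall fun x => ?_
    rw [Matrix.transpose_mul, Matrix.transpose_transpose, Matrix.mul_assoc,
      ← Matrix.mul_assoc (B₀ x.1), hB₀, Matrix.one_mul, hU']
  · filter_upwards [hl3] with x hx
    have h := congrArg (fun M => (U x.1)ᵀ * M * U x.1) ((hft x.1 x.2.1).balanced hx.2)
    simpa only [Matrix.mul_sub, Matrix.sub_mul, Matrix.mul_vecMulVec, Matrix.vecMulVec_mul,
      Matrix.mulVec_transpose, Matrix.transpose_mul, Matrix.transpose_transpose,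
      Matrix.mul_assoc] using h
  · filter_upwards [hl3] with x hx
    rw [Matrix.mul_assoc, (hft x.1 x.2.1).mul_eq_of_mul_eq_zero hx.1 hx.2, Matrix.mul_assoc]
  · have h := tendsto_zero_of_quadratic_form (secondMoment_posSemidef hmoment) hinv
      (hl2.congr fun x => risk_eq hmoment vs Bs _ _)
    have h' := h.add_const (Bsᵀ *ᵥ vs)
    rw [zero_add] at h'
    refine h'.congr fun x => ?_
    rw [sub_add_cancel, transpose_rotate_mulVec (hU _)]

/-- The initial head lies near the exceptional hyperplanes with small probability, uniformly in the
rotation `U`. -/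
lemma exists_measure_head_near_le {k : ℕ} {vs : Fin k → ℝ} (hvs : vs ≠ 0) {Ω : Type*}
    [MeasurableSpace Ω] {P : Measure Ω} {σsq : ℝ≥0} {v₀ : Ω → Fin k → ℝ}
    (hv₀ : HasLaw v₀ (isoGaussian k σsq) P) {η : ℝ≥0∞} (hη : 0 < η) :
    ∃ δ : ℝ, 0 < δ ∧ ∀ U : Matrix (Fin k) (Fin k) ℝ, U * Uᵀ = 1 →
      P {ω | |(v₀ ω ⬝ᵥ (U *ᵥ vs)) ^ 2 - (vs ⬝ᵥ vs) ^ 2| < δ} ≤ η := by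
  have hpos : 0 < (vs ⬝ᵥ vs) ^ 2 :=
    pow_pos (lt_of_le_of_ne (zero_le_dotProduct_self vs)
      fun h => hvs (dotProduct_self_eq_zero.1 h.symm)) 2
  obtain ⟨δ, hδ, hle⟩ :=
    exists_gaussianReal_sq_near_le (σsq * (vs ⬝ᵥ vs).toNNReal) hpos hη
  refine ⟨δ, hδ, fun U hU => ?_⟩
  have hmeas : Measurable fun v : Fin k → ℝ => v ⬝ᵥ (U *ᵥ vs) :=
    (continuous_id.dotProduct continuous_const).measurable
  -- the law of `v₀ ⬝ᵥ U vs` depends on `U` only through the length of `U vs`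
  have hlaw := isoGaussian_map_dotProduct σsq (U *ᵥ vs)
  rw [mulVec_dotProduct, Matrix.mulVec_mulVec, mul_eq_one_comm.1 hU, Matrix.one_mulVec,
    ← hv₀.map_eq, AEMeasurable.map_map_of_aemeasurable hmeas.aemeasurable hv₀.aemeasurable] at hlaw
  rw [← hlaw, Measure.map_apply_of_aemeasurable (hmeas.comp_aemeasurable hv₀.aemeasurable)
    (measurableSet_lt (by fun_prop) measurable_const)] at hle
  exact hle

/-- The training inputs almost surely lie in the column space of `F`. -/
lemma ae_mul_projection_eq_zero {n d m : ℕ} {F : Matrix (Fin d) (Fin m) ℝ} (hF : Fᵀ * F = 1)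
    {Pz : Measure (Fin m → ℝ)} {Ω : Type*} [MeasurableSpace Ω] {P : Measure Ω}
    {X : Ω → Matrix (Fin n) (Fin d) ℝ}
    (hX : ∀ j, HasLaw (fun ω => X ω j) (Pz.map fun z => F *ᵥ z) P) :
    ∀ᵐ ω ∂P, X ω * (1 - F * Fᵀ) = 0 := by
  have hmeas : Measurable fun z : Fin m → ℝ => F *ᵥ z :=
    (continuous_const.matrix_mulVec continuous_id).measurable
  have hQmeas : Measurable fun x : Fin d → ℝ => (1 - F * Fᵀ) *ᵥ x :=
    (continuous_const.matrix_mulVec continuous_id).measurable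
  have hrow : ∀ j, ∀ᵐ ω ∂P, (1 - F * Fᵀ) *ᵥ X ω j = 0 := fun j => by
    refine ae_of_ae_map (hX j).aemeasurable (p := fun x => (1 - F * Fᵀ) *ᵥ x = 0) ?_
    rw [(hX j).map_eq, ae_map_iff hmeas.aemeasurable (measurableSet_eq_fun hQmeas
      measurable_const)]
    refine Eventually.of_forall fun z => ?_
    rw [Matrix.mulVec_mulVec, Matrix.sub_mul, Matrix.mul_assoc, hF, Matrix.mul_one, Matrix.one_mul,
      sub_self, Matrix.zero_mulVec]
  filter_upwards [ae_all_iff.2 hrow] with ω hω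
  ext j l
  have h := congrFun (hω j) l
  have hsymm : (1 - F * Fᵀ)ᵀ = 1 - F * Fᵀ := by simp
  rw [← hsymm, Matrix.mulVec_transpose] at h
  exact h

end LinearTransfer

theorem mainTheorem2 {d k m n : ℕ} (hkm : k < m) (hmd : m + k < d) (hmn : m ≤ n)
    -- ground truth: head and feature extractor
    (vs : Fin k → ℝ) (hvs : vs ≠ 0)
    (Bs : Matrix (Fin k) (Fin d) ℝ) (hBs : Bs * Bsᵀ = 1)
    -- in-distribution subspace and law, out-of-distribution law
    (S : Submodule ℝ (EuclideanSpace ℝ (Fin d)))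
    (Pid : Measure (Fin d → ℝ)) (hPid : LinearTransfer.IsSubspaceLaw m S Pid)
    (Pood : Measure (Fin d → ℝ)) [IsProbabilityMeasure Pood]
    (hmoment : ∀ i, MemLp (fun x : Fin d → ℝ => x i) 2 Pood)
    (hinv : IsUnit (LinearTransfer.secondMoment Pood))
    -- nondegenerate angles
    (hS : 0 < LinearTransfer.cosMaxAngle (LinearTransfer.rowspace Bs) S)
    (hSperp : 0 < LinearTransfer.cosMaxAngle (LinearTransfer.rowspace Bs) Sᗮ)
    -- pretrained feature extractors converging to the ground truth
    (B₀ : ℕ → Matrix (Fin k) (Fin d) ℝ) (hB₀ : ∀ i, B₀ i * (B₀ i)ᵀ = 1)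
    (hlim : Tendsto (fun i => LinearTransfer.extractorDist (B₀ i) Bs) atTop (𝓝 0))
    -- random training inputs (the rows of `X`) and random initial head
    {Ω : Type*} [MeasurableSpace Ω] (P : Measure Ω) [IsProbabilityMeasure P]
    (X : Ω → Matrix (Fin n) (Fin d) ℝ)
    (hXlaw : ∀ j, HasLaw (fun ω => X ω j) Pid P)
    (hXindep : iIndepFun (fun j ω => X ω j) P)
    (σsq : ℝ≥0) (v₀ : Ω → Fin k → ℝ)
    (hv₀ : HasLaw v₀ (LinearTransfer.isoGaussian k σsq) P)
    -- linear probing and fine-tuning trajectories from the head `v₀` and the extractor `B₀ i`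
    (vlp : ℕ → Ω → ℝ → Fin k → ℝ)
    (hlp : ∀ i ω, LinearTransfer.IsLinearProbing (X ω) (X ω *ᵥ (Bsᵀ *ᵥ vs)) (v₀ ω) (B₀ i)
      (vlp i ω))
    (vft : ℕ → Ω → ℝ → Fin k → ℝ) (Bft : ℕ → Ω → ℝ → Matrix (Fin k) (Fin d) ℝ)
    (hft : ∀ i ω, LinearTransfer.IsFineTuning (X ω) (X ω *ᵥ (Bsᵀ *ᵥ vs)) (v₀ ω) (B₀ i)
      (vft i ω) (Bft i ω)) :
    ∃ vlpInf : ℕ → Ω → Fin k → ℝ,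
      (∀ i ω, Tendsto (vlp i ω) atTop (𝓝 (vlpInf i ω))) ∧
      -- the denominator of the ratio vanishes with probability tending to zero
      Tendsto (fun i => P {ω | LinearTransfer.infRisk Pood vs Bs (vft i ω) (Bft i ω) = 0})
        atTop (𝓝 0) ∧
      TendstoInMeasure P
        (fun i ω => LinearTransfer.risk Pood vs Bs (vlpInf i ω) (B₀ i) /
          LinearTransfer.infRisk Pood vs Bs (vft i ω) (Bft i ω))
        atTop (fun _ => 0) := by
  open LinearTransfer in
  obtain ⟨Pz, F, hPz, hPzac, hF, rfl, rfl⟩ := hPid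
  have hFmeas : Measurable fun z : Fin m → ℝ => F *ᵥ z :=
    (continuous_const.matrix_mulVec continuous_id).measurable
  have hBmeas : Measurable fun x : Fin d → ℝ => Bs *ᵥ x :=
    (continuous_const.matrix_mulVec continuous_id).measurable
  have : IsProbabilityMeasure (Pz.map fun z => F *ᵥ z) :=
    Measure.isProbabilityMeasure_map hFmeas.aemeasurable
  obtain ⟨L₁, hL₁⟩ := exists_leftInverse_of_angle hkm.le hBs hF hS
  obtain ⟨L₂, hL₂⟩ := exists_leftInverse_of_angle_orthogonal hmd.le hBs hF hSperp
  obtain ⟨U, hU, hUlim⟩ := exists_rotations hlim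
  have hXQ := ae_mul_projection_eq_zero hF hXlaw
  have hsurj : Function.Surjective (Bs * F).mulVec := fun y => ⟨L₁ᵀ *ᵥ y, by
    have h := congrArg Matrix.transpose hL₁
    rw [Matrix.transpose_mul, Matrix.transpose_mul, Matrix.transpose_transpose,
      Matrix.transpose_transpose, Matrix.transpose_one] at h
    rw [Matrix.mulVec_mulVec, h, Matrix.one_mulVec]⟩
  have hinj := ae_mulVec_injective (hkm.le.trans hmn) (Bs := Bs) (fun W hW => by
    have h := submodule_null_of_map hPzac hsurj hW
    rw [Measure.map_map hBmeas hFmeas]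
    simpa only [Function.comp_def, Matrix.mulVec_mulVec] using h) hXlaw hXindep
  -- off an event of small probability, the risk of fine-tuning stays above a threshold
  have hthreshold : ∀ η : ℝ≥0∞, 0 < η → ∃ ρ : ℝ, 0 < ρ ∧ ∀ᶠ i in atTop,
      P {ω | infRisk Pood vs Bs (vft i ω) (Bft i ω) < ρ} ≤ η := fun η hη => by
    obtain ⟨δ, hδ, hhead⟩ := exists_measure_head_near_le hvs hv₀ hη
    obtain ⟨ρ, hρ, hev⟩ := exists_infRisk_threshold hmoment hinv hBs
      (by simp : (1 - F * Fᵀ)ᵀ = 1 - F * Fᵀ) hL₂ hB₀ hU hUlim hft hδ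
    refine ⟨ρ, hρ, ?_⟩
    filter_upwards [hev] with i hi
    refine (measure_mono_ae ?_).trans (hhead (U i) (hU i))
    filter_upwards [hXQ] with ω hω hlt
    exact hi ω hω hlt
  choose vlpInf hvlpInf hnormal using fun i ω => (hlp i ω).exists_tendsto
  refine ⟨vlpInf, hvlpInf, ?_, ?_⟩
  · refine ENNReal.tendsto_nhds_zero.2 fun η hη => ?_
    obtain ⟨ρ, hρ, hev⟩ := hthreshold η hη
    filter_upwards [hev] with i hi
    exact (measure_mono fun ω (hω : _ = _) => lt_of_eq_of_lt hω hρ).trans hi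
  -- a large ratio needs a small denominator or a large numerator
  · rw [tendstoInMeasure_iff_dist]
    intro ε hε
    refine ENNReal.tendsto_nhds_zero.2 fun η hη => ?_
    obtain ⟨ρ, hρ, hev⟩ := hthreshold (η / 2) (ENNReal.half_pos hη.ne')
    have hprobe := tendsto_measure_linearProbing (vs := vs) hmoment
      (fun j => (hXlaw j).aemeasurable) hinj hUlim (mul_pos hε hρ)
    filter_upwards [hev, ENNReal.tendsto_nhds_zero.1 hprobe (η / 2) (ENNReal.half_pos hη.ne')]
      with i h1 h2
    refine (measure_mono ?_).trans ((measure_union_le _ _).trans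
      ((add_le_add h1 h2).trans (ENNReal.add_halves η).le))
    intro ω hω
    refine or_iff_not_imp_left.2 fun hge => ⟨(U i)ᵀ *ᵥ vlpInf i ω, ?_, ?_⟩
    · rw [transpose_rotate_mulVec (hU i), ← Matrix.mulVec_mulVec, hnormal, Matrix.mulVec_zero]
    · have hge' : ρ ≤ infRisk Pood vs Bs (vft i ω) (Bft i ω) := not_lt.1 hge
      have hpos := hρ.trans_le hge'
      have hω' : ε ≤ dist (risk Pood vs Bs (vlpInf i ω) (B₀ i) /
          infRisk Pood vs Bs (vft i ω) (Bft i ω)) 0 := hω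
      rw [Real.dist_0_eq_abs, abs_of_nonneg (div_nonneg (risk_nonneg _ _ _ _ _) hpos.le),
        le_div_iff₀ hpos] at hω'
      rw [risk_rotate hmoment vs Bs _ _ (hU i)]
      exact (mul_le_mul_of_nonneg_left hge' hε.le).trans hω'
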